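/- Let $d\ge 1$ be an integer and let $\lambda>0$. **Notation.** Let $\mathbb H^d=\{x\in\mathbb R^{d+1}: x_0^2-x_1^2-\dots-x_d^2=1,\ x_0>0\}$ be the hyperboloid model of hyperbolic space, with the hyperbolic distance $d_{\rm hyp}(x,y)=\operatorname{arcosh}(x_0y_0-x_1y_1-\dots-x_dy_d)$, the Riemannian volume measure $\nu_{\rm hyp}$, the apex $e=(1,0,\dots,0)$ and the gnomonic projection $\Pi_{\rm gn}:\mathbb H^d\to\{v\in\mathbb R^d:\|v\|<1\}$, $\Pi_{\rm gn}(x)=(x_1/x_0,\dots,x_d/x_0)$. For a Poisson process $\eta$ on $\mathbb H^d$, the Voronoi cell of the apex in $\eta\cup\{e\}$ is $$V(\eta)=\{x\in\mathbb H^d:\ d_{\rm hyp}(x,e)\le d_{\rm hyp}(x,y)\text{ for all }y\in\eta\}.$$ For $\alpha>0$ and $\beta>d/2$, the beta$^*$ set $P_{d,\alpha,\beta}$ is the closed convex hull of the atoms of a Poisson process on $\{x\in\mathbb R^d:\|x\|>1\}$ with intensity $\alpha\,\tilde c_{d,\beta}\,(\|x\|^2-1)^{-\beta}$ with respect to Lebesgue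 measure, where $\tilde c_{d,\beta}=\frac{\Gamma(\beta)}{\pi^{d/2}\,\Gamma(\beta-d/2)}$. The convex dual of $K\subset\mathbb R^d$ is $K^\circ=\{x\in\mathbb R^d:\langle x,y\rangle\le 1\text{ for all }y\in K\}$. Equality of distributions is that of random closed subsets of $\mathbb R^d$, with respect to the $\sigma$-algebra generated by the families of closed sets that meet a given compact set. **(I)** Let $\beta>\max(d/2,1)$ and let $\eta$ be a Poisson process on $\mathbb H^d$ whose intensity with respect to $\nu_{\rm hyp}$ is $x\mapsto\lambda\,\bigl(\sinh\tfrac{d_{\rm hyp}(e,x)}2\bigr)^{2\beta-2d}$. Then the closure of $\Pi_{\rm gn}(V(\eta))$ has the same distribution as $P_{d,\alpha,\beta}^\circ$ with $\alpha=2^d\lambda/\tilde c_{d,\beta}$. **(II)** Let $\eta$ be the stationary Poisson process on $\mathbb H^d$ of intensity $\lambda$, i.e. with intensity measure $\lambda\,\nu_{\rm hyp}$, and let $V^{\rm typ}_{d,\lambda}=V(\eta)$ be the typical cell of the stationary hyperbolic Poisson–Voronoi tessellation. Then $\Pi_{\rm gn}(V^{\rm typ}_{d,\lambda})$ is almost surely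 closed, and it has the same distribution as $P_{d,\alpha,d}^\circ$ with $$\alpha=\frac{2^d\lambda}{\tilde c_{d,d}}=\frac{2^d\,\pi^{d/2}\,\lambda\,\Gamma(d/2)}{\Gamma(d)}.$$ This includes the case $d=1$. -/

import Mathlib

open MeasureTheory ProbabilityTheory TopologicalSpace
open scoped ENNReal

noncomputable section

namespace HypVoronoi

/-! ### Poisson processes -/

/-- The Poisson distribution on `{0, 1, 2, …, ∞}` with mean `m ∈ [0, ∞]`; for `m = ∞` it is the
unit mass at `∞`. -/
def poissonLaw (m : ℝ≥0∞) : Measure ℕ∞ :=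
  if m = ∞ then Measure.dirac ⊤
  else (poissonMeasure m.toNNReal).map (fun n : ℕ => (n : ℕ∞))

/-- The random set `η` of points of `X`, defined on the probability space `(Ω, P)`, is a (simple)
Poisson process with intensity measure `μ`: the number of points of `η` in a measurable set `A`
is a random variable which has the Poisson distribution with mean `μ A`, and the numbers of points
in finitely many pairwise disjoint measurable sets are independent. -/
structure IsPoissonProcess {Ω X : Type*} [MeasurableSpace Ω] [MeasurableSpace X]
    (P : Measure Ω) (μ : Measure X) (η : Ω → Set X) : Prop where
  measurable_count : ∀ A : Set X, MeasurableSet A → Measurable (fun ω => (η ω ∩ A).encard)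
  law_count : ∀ A : Set X, MeasurableSet A →
    P.map (fun ω => (η ω ∩ A).encard) = poissonLaw (μ A)
  indep_count : ∀ (n : ℕ) (A : Fin n → Set X), (∀ i, MeasurableSet (A i)) →
    Pairwise (Function.onFun Disjoint A) → iIndepFun (fun i ω => (η ω ∩ A i).encard) P

/-! ### Random closed sets and their distributions -/

/-- The Fell (hit-or-miss) σ-algebra on the space of closed subsets of `E`, generated by the
families of all closed sets that meet a given compact set. -/
instance fellMeasurableSpace (E : Type*) [TopologicalSpace E] : MeasurableSpace (Closeds E) :=
  MeasurableSpace.generateFrom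
    {S | ∃ K : Set E, IsCompact K ∧ S = {C : Closeds E | ((C : Set E) ∩ K).Nonempty}}

/-- Two random sets `Z` and `Z'`, on possibly different probability spaces, are almost surely
closed and have, as random closed sets, the same distribution. -/
def SameLaw {E Ω Ω' : Type*} [TopologicalSpace E] [MeasurableSpace Ω] [MeasurableSpace Ω']
    (Z : Ω → Set E) (P : Measure Ω) (Z' : Ω' → Set E) (P' : Measure Ω') : Prop :=
  (∀ᵐ ω ∂P, IsClosed (Z ω)) ∧ (∀ᵐ ω' ∂P', IsClosed (Z' ω')) ∧
    IdentDistrib (fun ω => Closeds.closure (Z ω)) (fun ω' => Closeds.closure (Z' ω')) P P'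

/-! ### Beta-star sets and convex duals -/

/-- The convex dual `K° = {x : ⟨x, y⟩ ≤ 1 for all y ∈ K}`. -/
def convexDual {d : ℕ} (K : Set (EuclideanSpace ℝ (Fin d))) : Set (EuclideanSpace ℝ (Fin d)) :=
  {x | ∀ y ∈ K, inner ℝ x y ≤ 1}

/-- The constant `c̃_{d,β} = Γ(β) / (π^{d/2} Γ(β - d/2))`. -/
def cTilde (d : ℕ) (β : ℝ) : ℝ :=
  Real.Gamma β / (Real.pi ^ ((d : ℝ) / 2) * Real.Gamma (β - (d : ℝ) / 2))

/-- The measure on `{x ∈ ℝ^d : ‖x‖ > 1}` with Lebesgue density `α c̃_{d,β} (‖x‖² - 1)^{-β}`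
(viewed as a measure on `ℝ^d`). -/
def betaStarIntensity (d : ℕ) (α β : ℝ) : Measure (EuclideanSpace ℝ (Fin d)) :=
  (volume.restrict {x | 1 < ‖x‖}).withDensity
    (fun x => ENNReal.ofReal (α * cTilde d β / (‖x‖ ^ 2 - 1) ^ β))

/-- The beta-star set: the closed convex hull of the points of the process. -/
def betaStarSet {d : ℕ} (ζ : Set (EuclideanSpace ℝ (Fin d))) : Set (EuclideanSpace ℝ (Fin d)) :=
  closedConvexHull ℝ ζ

/-! ### The hyperboloid model of hyperbolic space -/

/-- The Minkowski product `B(x, y) = x₀ y₀ - x₁ y₁ - … - x_d y_d` on `ℝ^{d+1}`. -/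
def minkowski {d : ℕ} (x y : EuclideanSpace ℝ (Fin (d + 1))) : ℝ :=
  x 0 * y 0 - ∑ i : Fin d, x i.succ * y i.succ

/-- The upper sheet `ℍ^d` of the hyperboloid `B(x, x) = 1`. -/
abbrev Hyperboloid (d : ℕ) : Type :=
  {x : EuclideanSpace ℝ (Fin (d + 1)) // minkowski x x = 1 ∧ 0 < x 0}

/-- The hyperbolic distance `arcosh B(x, y)` (not the distance inherited from `ℝ^{d+1}`). -/
def hypDist {d : ℕ} (x y : Hyperboloid d) : ℝ :=
  Real.arcosh (minkowski x.1 y.1)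

/-- The graph map `y ↦ (√(1 + ‖y‖²), y)` from `ℝ^d` to `ℝ^{d+1}`, whose image is `ℍ^d`. -/
def graphMap (d : ℕ) (y : EuclideanSpace ℝ (Fin d)) : EuclideanSpace ℝ (Fin (d + 1)) :=
  WithLp.toLp 2 (Fin.cons (√(1 + ‖y‖ ^ 2)) (fun i => y i))

theorem graphMap_mem (d : ℕ) (y : EuclideanSpace ℝ (Fin d)) :
    minkowski (graphMap d y) (graphMap d y) = 1 ∧ 0 < graphMap d y 0 := by
  have h : (0 : ℝ) < 1 + ‖y‖ ^ 2 := by positivity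
  constructor
  · simp only [minkowski, graphMap, Fin.cons_zero, Fin.cons_succ]
    rw [Real.mul_self_sqrt h.le, EuclideanSpace.real_norm_sq_eq]
    simp [sq]
  · simpa [graphMap] using h

/-- The global parametrization of `ℍ^d` by `ℝ^d` given by the graph map. -/
def hypParam (d : ℕ) (y : EuclideanSpace ℝ (Fin d)) : Hyperboloid d :=
  ⟨graphMap d y, graphMap_mem d y⟩

/-- The matrix of the Riemannian metric of `ℍ^d` (the restriction of `-B` to the tangent spaces)
in the global parametrization: `g_{ij} = -B(∂_i F, ∂_j F)`, where `F` is the graph map. -/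
def metricMatrix (d : ℕ) (y : EuclideanSpace ℝ (Fin d)) : Matrix (Fin d) (Fin d) ℝ :=
  Matrix.of fun i j =>
    -minkowski (fderiv ℝ (graphMap d) y (EuclideanSpace.single i 1))
      (fderiv ℝ (graphMap d) y (EuclideanSpace.single j 1))

/-- The hyperbolic volume measure on `ℍ^d`, that is, the Riemannian volume `√(det g) dy`
transported to `ℍ^d` by the global parametrization. -/
def hypVolume (d : ℕ) : Measure (Hyperboloid d) :=
  (volume.withDensity
    (fun y => ENNReal.ofReal (√(metricMatrix d y).det))).map (hypParam d)

/-- The apex `e = (1, 0, …, 0)` of `ℍ^d`. -/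
def apex (d : ℕ) : Hyperboloid d :=
  ⟨EuclideanSpace.single 0 1, by simp [minkowski]⟩

/-- The gnomonic projection: the segment from `0` to `x ∈ ℍ^d` meets the hyperplane `{x₀ = 1}` in
the point `(1, v)`, where `v = (x₁, …, x_d) / x₀`. -/
def gnomonic {d : ℕ} (x : Hyperboloid d) : EuclideanSpace ℝ (Fin d) :=
  WithLp.toLp 2 (fun i => x.1 i.succ / x.1 0)

/-- The Voronoi cell of `x` in the set of points `S`. -/
def voronoiCell {d : ℕ} (x : Hyperboloid d) (S : Set (Hyperboloid d)) : Set (Hyperboloid d) :=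
  {y | ∀ z ∈ S, hypDist y x ≤ hypDist y z}

/-- The measure on `ℍ^d` with density `λ sinh(d_hyp(e, x) / 2)^{2β - 2d}` with respect to the
hyperbolic volume. -/
def voronoiIntensity (d : ℕ) (lam β : ℝ) : Measure (Hyperboloid d) :=
  (hypVolume d).withDensity
    (fun x => ENNReal.ofReal (lam * Real.sinh (hypDist (apex d) x / 2) ^ (2 * β - 2 * d)))

end HypVoronoi

end

namespace HypVoronoi

/-! ### Void probabilities of Poisson processes -/

section Poisson

variable {Ω Ω' X Y : Type*} [MeasurableSpace Ω] [MeasurableSpace Ω'] [MeasurableSpace X]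
  [MeasurableSpace Y]

/-! Write `x = (x₀, x')`. The inequality `x₀ ≤ x₀ z₀ - ⟨x', z'⟩`, which says that `x` is at least as
close to the apex as to `z`, becomes `⟨x'/x₀, z'/(z₀ - 1)⟩ ≤ 1` after division. So in gnomonic
coordinates the cell is the open unit ball intersected with the dual of the points `z'/(z₀ - 1)`
(`gnomonic_image_voronoiCell`). The map `bisectorPole` is injective, with inverse `x ↦ 2x/(‖x‖² -
1)` off the apex, and it carries the Voronoi intensity exactly to the beta-star intensity
(`map_bisectorPole_voronoiIntensity`). Hence the poles form a Poisson process with the same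
intensity as the beta-star process.

Equality of laws follows because void probabilities determine the law of a Poisson process, and
whether a dual meets a compact set is measurable with respect to void events
(`measurable_dualClosed`).

It remains to remove the open ball. For `β ≥ 1` every neighbourhood of a point of the unit sphere
has infinite intensity, so the dual almost surely lies in the closed ball; being convex and
containing `0`, it is the closure of its part in the open ball. This gives (I). For (II), where `β =
d`, the dual almost surely misses the sphere itself: for `d ≥ 2` a net of polynomially many cells
covers the sphere, and each contains a point of the dual with exponentially small probability
(`measure_hit_sphere_le`); `d = 1` is settled directly. -/

theorem IsPoissonProcess.image {P : Measure Ω} {μ : Measure X} {η : Ω → Set X}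
    (h : IsPoissonProcess P μ η) {f : X → Y} (hf : Measurable f) (hinj : Function.Injective f) :
    IsPoissonProcess P (μ.map f) (fun ω => f '' η ω) := by
  have key : ∀ (ω : Ω) (A : Set Y), (f '' η ω ∩ A).encard = (η ω ∩ f ⁻¹' A).encard := fun ω A => by
    rw [← Set.image_inter_preimage, hinj.encard_image]
  refine ⟨fun A hA => ?_, fun A hA => ?_, fun n A hA hd => ?_⟩
  · simp only [key]
    exact h.measurable_count _ (hf hA)
  · simp only [key]
    rw [h.law_count _ (hf hA), Measure.map_apply hf hA]
  · simp only [key]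
    exact h.indep_count n _ (fun i => hf (hA i)) fun i j hij => (hd hij).preimage f

theorem IsPoissonProcess.measurableSet_void {P : Measure Ω} {μ : Measure X} {η : Ω → Set X}
    (h : IsPoissonProcess P μ η) {A : Set X} (hA : MeasurableSet A) :
    MeasurableSet {ω | η ω ∩ A = ∅} := by
  have : {ω | η ω ∩ A = ∅} = (fun ω => (η ω ∩ A).encard) ⁻¹' {0} := by
    ext ω; simp
  rw [this]
  exact h.measurable_count A hA (measurableSet_singleton 0)

theorem IsPoissonProcess.void_eq {P : Measure Ω} {μ : Measure X} {η : Ω → Set X}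
    (h : IsPoissonProcess P μ η) {A : Set X} (hA : MeasurableSet A) :
    P {ω | η ω ∩ A = ∅} = poissonLaw (μ A) {0} := by
  rw [← h.law_count A hA, Measure.map_apply (h.measurable_count A hA) (measurableSet_singleton 0)]
  congr 1
  ext ω; simp

theorem poissonLaw_top_zero : poissonLaw ∞ {0} = 0 := by
  rw [poissonLaw, if_pos rfl, Measure.dirac_apply' _ (measurableSet_singleton 0)]
  simp

theorem poissonLaw_zero_le {m : ℝ≥0∞} {c : ℝ} (hc : ENNReal.ofReal c ≤ m) :
    poissonLaw m {0} ≤ ENNReal.ofReal (Real.exp (-c)) := by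
  by_cases hm : m = ∞
  · rw [hm, poissonLaw_top_zero]; exact zero_le
  · have hpre : (fun n : ℕ => (n : ℕ∞)) ⁻¹' {0} = {0} := by ext; simp
    rw [poissonLaw, if_neg hm, Measure.map_apply (measurable_of_countable _)
      (measurableSet_singleton 0), hpre, poissonMeasure_singleton]
    simp only [pow_zero, mul_one, Nat.factorial_zero, Nat.cast_one, div_one]
    refine ENNReal.ofReal_le_ofReal (Real.exp_le_exp.2 (neg_le_neg ?_))
    have := ENNReal.toReal_mono hm hc
    rw [ENNReal.toReal_ofReal'] at this
    exact (le_max_left c 0).trans this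

theorem IsPoissonProcess.void_le {P : Measure Ω} {μ : Measure X} {η : Ω → Set X}
    (h : IsPoissonProcess P μ η) {A : Set X} (hA : MeasurableSet A) {c : ℝ}
    (hc : ENNReal.ofReal c ≤ μ A) :
    P {ω | η ω ∩ A = ∅} ≤ ENNReal.ofReal (Real.exp (-c)) :=
  (h.void_eq hA).trans_le (poissonLaw_zero_le hc)

theorem IsPoissonProcess.ae_nonempty_inter {P : Measure Ω} {μ : Measure X} {η : Ω → Set X}
    (h : IsPoissonProcess P μ η) {A : Set X} (hA : MeasurableSet A) (hμ : μ A = ∞) :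
    ∀ᵐ ω ∂P, (η ω ∩ A).Nonempty := by
  have h0 : P {ω | η ω ∩ A = ∅} = 0 := by rw [h.void_eq hA, hμ, poissonLaw_top_zero]
  rw [ae_iff]
  simpa only [Set.not_nonempty_iff_eq_empty] using h0

theorem IsPoissonProcess.ae_subset {P : Measure Ω} {μ : Measure X} [IsProbabilityMeasure P]
    {η : Ω → Set X} (h : IsPoissonProcess P μ η) {A : Set X} (hA : MeasurableSet A)
    (hμ : μ Aᶜ = 0) : ∀ᵐ ω ∂P, η ω ⊆ A := by
  have h0 : P {ω | η ω ∩ Aᶜ = ∅} = 1 := by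
    rw [h.void_eq hA.compl, hμ, poissonLaw, if_neg ENNReal.zero_ne_top,
      Measure.map_apply (measurable_of_countable _) (measurableSet_singleton 0)]
    have hpre : (fun n : ℕ => (n : ℕ∞)) ⁻¹' {0} = {0} := by ext; simp
    rw [hpre, poissonMeasure_singleton]
    simp
  have h1 := (prob_compl_eq_zero_iff (h.measurableSet_void hA.compl)).2 h0
  rw [ae_iff]
  convert h1 using 2
  ext ω
  simp [← Set.disjoint_iff_inter_eq_empty, Set.disjoint_compl_right_iff_subset]

/-- The type of point configurations in `X`, with the σ-algebra generated by the void events. -/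
structure Config (X : Type*) where
  /-- The underlying set of points. -/
  points : Set X

/-- The family of all void events. -/
def voidEvents (X : Type*) [MeasurableSpace X] : Set (Set (Config X)) :=
  {S | ∃ A : Set X, MeasurableSet A ∧ S = {ξ | ξ.points ∩ A = ∅}}

instance : MeasurableSpace (Config X) := MeasurableSpace.generateFrom (voidEvents X)

/-- Avoiding both `A` and `B` is the same as avoiding `A ∪ B`. -/
theorem isPiSystem_voidEvents : IsPiSystem (voidEvents X) := by
  rintro _ ⟨A, hA, rfl⟩ _ ⟨B, hB, rfl⟩ -
  refine ⟨A ∪ B, hA.union hB, ?_⟩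
  ext ξ
  simp [Set.inter_union_distrib_left]

theorem IsPoissonProcess.measurable_config {P : Measure Ω} {μ : Measure X} {η : Ω → Set X}
    (h : IsPoissonProcess P μ η) : Measurable (fun ω => Config.mk (η ω)) := by
  refine measurable_generateFrom ?_
  rintro _ ⟨A, hA, rfl⟩
  exact h.measurableSet_void hA

/-- The law of a Poisson process is determined by its intensity measure. -/
theorem IsPoissonProcess.identDistrib {P : Measure Ω} [IsProbabilityMeasure P] {P' : Measure Ω'}
    [IsProbabilityMeasure P'] {μ : Measure X} {η : Ω → Set X} {ζ : Ω' → Set X}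
    (h : IsPoissonProcess P μ η) (h' : IsPoissonProcess P' μ ζ) :
    IdentDistrib (fun ω => Config.mk (η ω)) (fun ω => Config.mk (ζ ω)) P P' := by
  refine ⟨h.measurable_config.aemeasurable, h'.measurable_config.aemeasurable, ?_⟩
  have := Measure.isProbabilityMeasure_map (μ := P) h.measurable_config.aemeasurable
  have := Measure.isProbabilityMeasure_map (μ := P') h'.measurable_config.aemeasurable
  refine ext_of_generate_finite (voidEvents X) rfl isPiSystem_voidEvents ?_ (by simp)
  rintro _ ⟨A, hA, rfl⟩
  have hm : MeasurableSet {ξ : Config X | ξ.points ∩ A = ∅} :=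
    MeasurableSpace.measurableSet_generateFrom ⟨A, hA, rfl⟩
  rw [Measure.map_apply h.measurable_config hm, Measure.map_apply h'.measurable_config hm]
  exact (h.void_eq hA).trans (h'.void_eq hA).symm

theorem measurableSet_config_hit {A : Set X} (hA : MeasurableSet A) :
    MeasurableSet {ξ : Config X | (ξ.points ∩ A).Nonempty} := by
  have hm : MeasurableSet {ξ : Config X | ξ.points ∩ A = ∅} :=
    MeasurableSpace.measurableSet_generateFrom ⟨A, hA, rfl⟩
  convert hm.compl using 1
  ext ξ
  simp [Set.nonempty_iff_ne_empty]

end Poisson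

/-! ### Convex duals as random closed sets -/

section Dual

variable {d : ℕ}

local notation "E" => EuclideanSpace ℝ (Fin d)

theorem isClosed_convexDual (K : Set E) : IsClosed (convexDual K) := by
  have : convexDual K = ⋂ y ∈ K, {x | inner ℝ x y ≤ 1} := by ext; simp [convexDual]
  rw [this]
  exact isClosed_biInter fun y _ => isClosed_le (by fun_prop) continuous_const

/-- Each constraint on the points is a closed half-space, so it passes to the closed convex hull.
Thus only the atoms matter. -/
theorem convexDual_betaStarSet (K : Set E) : convexDual (betaStarSet K) = convexDual K := by
  refine Set.Subset.antisymm (fun x hx y hy => hx y (subset_closedConvexHull hy)) fun x hx => ?_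
  have hsub : closedConvexHull ℝ K ⊆ {y | inner ℝ x y ≤ 1} := by
    refine closedConvexHull_min hx ?_ (isClosed_le (by fun_prop) continuous_const)
    exact convex_halfSpace_le (innerₗ E x).isLinear 1
  exact fun y hy => hsub hy

/-- The closed set `(ξ)°`, as a function of the configuration `ξ`. -/
def dualClosed (ξ : Config E) : Closeds E := ⟨convexDual ξ.points, isClosed_convexDual _⟩

/-- If the dual misses `K`, each `v ∈ K` is excluded by a strict inequality at some point of `ξ`.
Strictness survives small changes of both `v` and the point, so compactness leaves finitely many
basic open sets as witnesses. This reduces an uncountable condition to countably many hit events. -/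
theorem exists_basis_cover {K : Set E} (hK : IsCompact K) {ξ : Set E}
    (h : ¬ (convexDual ξ ∩ K).Nonempty) :
    ∃ F : Finset (Set E), (F : Set (Set E)) ⊆ countableBasis E ∧
      (∀ v ∈ K, ∃ U ∈ F, ∀ x ∈ U, 1 < inner ℝ v x) ∧ ∀ U ∈ F, (ξ ∩ U).Nonempty := by
  have step : ∀ v ∈ K, ∃ U ∈ countableBasis E, (ξ ∩ U).Nonempty ∧
      ∃ W, IsOpen W ∧ v ∈ W ∧ ∀ w ∈ W, ∀ x ∈ U, 1 < inner ℝ w x := by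
    intro v hv
    have hv' : v ∉ convexDual ξ := fun hvξ => h ⟨v, hvξ, hv⟩
    simp only [convexDual, Set.mem_ofPred_eq, not_forall, not_le] at hv'
    obtain ⟨x, hx, hvx⟩ := hv'
    have hopen : IsOpen {p : E × E | 1 < inner ℝ p.1 p.2} :=
      isOpen_lt continuous_const (by fun_prop)
    obtain ⟨W, V, hW, hV, hvW, hxV, hWV⟩ := isOpen_prod_iff.1 hopen v x hvx
    obtain ⟨U, hU, hxU, hUV⟩ := (isBasis_countableBasis E).exists_subset_of_mem_open hxV hV
    exact ⟨U, hU, ⟨x, hx, hxU⟩, W, hW, hvW, fun w hw y hy =>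
      hWV (Set.mk_mem_prod hw (hUV hy))⟩
  choose! U hU hne W hW hvW hWU using step
  obtain ⟨t, ht, hcover⟩ := hK.elim_nhds_subcover W fun v hv => (hW v hv).mem_nhds (hvW v hv)
  classical
  refine ⟨t.image U, ?_, fun v hv => ?_, ?_⟩
  · intro V hV
    obtain ⟨v, hv, rfl⟩ := Finset.mem_image.1 (Finset.mem_coe.1 hV)
    exact hU v (ht v hv)
  · obtain ⟨w, hw, hvw⟩ := Set.mem_iUnion₂.1 (hcover hv)
    exact ⟨U w, Finset.mem_image_of_mem U hw, fun x hx => hWU w (ht w hw) v hvw x hx⟩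
  · intro V hV
    obtain ⟨v, hv, rfl⟩ := Finset.mem_image.1 hV
    exact hne v (ht v hv)

theorem measurable_dualClosed : Measurable (dualClosed (d := d)) := by
  refine measurable_generateFrom ?_
  rintro _ ⟨K, hK, rfl⟩
  have hS : Set.Countable {F : Finset (Set E) | (F : Set (Set E)) ⊆ countableBasis E ∧
      ∀ v ∈ K, ∃ U ∈ F, ∀ x ∈ U, 1 < inner ℝ v x} := by
    have hc := (Set.countable_ofPred_finite_subset (countable_countableBasis E)).preimage
      (Finset.coe_injective (α := Set E))
    refine hc.mono fun F hF => ?_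
    rw [Set.mem_preimage, Set.mem_ofPred_eq]
    exact ⟨F.finite_toSet, hF.1⟩
  -- The families `F` depend on `K` only, not on the configuration, and there are countably many of
  -- them.
  have heq : dualClosed ⁻¹' {C : Closeds E | ((C : Set E) ∩ K).Nonempty} =
      (⋃ F ∈ {F : Finset (Set E) | (F : Set (Set E)) ⊆ countableBasis E ∧
        ∀ v ∈ K, ∃ U ∈ F, ∀ x ∈ U, 1 < inner ℝ v x},
        ⋂ U ∈ F, {ξ : Config E | (ξ.points ∩ U).Nonempty})ᶜ := by
    ext ξ
    simp only [Set.mem_preimage, Set.mem_ofPred_eq, Set.mem_compl_iff, Set.mem_iUnion,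
      Set.mem_iInter, exists_prop, dualClosed, Closeds.coe_mk]
    rw [iff_not_comm, iff_comm]
    constructor
    · intro h
      obtain ⟨F, hF, hFK, hFξ⟩ := exists_basis_cover hK h
      exact ⟨F, ⟨hF, hFK⟩, hFξ⟩
    · rintro ⟨F, ⟨-, hFK⟩, hFξ⟩ ⟨v, hv, hvK⟩
      obtain ⟨U, hUF, hU⟩ := hFK v hvK
      obtain ⟨x, hx, hxU⟩ := hFξ U hUF
      exact absurd (hv x hx) (not_le.2 (hU x hxU))
  rw [heq]
  refine (MeasurableSet.biUnion hS fun F hF => Finset.measurableSet_biInter _ fun U hU => ?_).compl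
  exact measurableSet_config_hit (isOpen_of_mem_countableBasis (hF.1 hU)).measurableSet

theorem closure_eq_dualClosed {Z ξ : Set E} (h : closure Z = convexDual ξ) :
    Closeds.closure Z = dualClosed ⟨ξ⟩ := by
  ext1
  simpa [dualClosed] using h

/-- If `η` and `ζ` are Poisson processes with the same intensity measure, and `Z` is almost surely
closed and equal to the dual of `η`, then `Z` has the law of the dual of the hull of `ζ`. -/
theorem sameLaw_dual {Ω Ω' : Type*} [MeasurableSpace Ω] [MeasurableSpace Ω'] {P : Measure Ω}
    [IsProbabilityMeasure P] {P' : Measure Ω'} [IsProbabilityMeasure P'] {μ : Measure E}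
    {η : Ω → Set E} {ζ : Ω' → Set E} (h : IsPoissonProcess P μ η) (h' : IsPoissonProcess P' μ ζ)
    {Z : Ω → Set E} (hZ : ∀ᵐ ω ∂P, Z ω = convexDual (η ω)) :
    SameLaw Z P (fun ω' => convexDual (betaStarSet (ζ ω'))) P' := by
  simp only [convexDual_betaStarSet]
  refine ⟨?_, .of_forall fun _ => isClosed_convexDual _, ?_⟩
  · filter_upwards [hZ] with ω hω
    rw [hω]
    exact isClosed_convexDual _
  · have hid := (h.identDistrib h').comp (measurable_dualClosed (d := d))
    have e' : (fun ω' => Closeds.closure (convexDual (ζ ω'))) =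
        dualClosed ∘ fun ω' => Config.mk (ζ ω') :=
      funext fun ω' => closure_eq_dualClosed (isClosed_convexDual _).closure_eq
    have e : (fun ω => Closeds.closure (Z ω)) =ᵐ[P] dualClosed ∘ fun ω => Config.mk (η ω) := by
      filter_upwards [hZ] with ω hω
      exact closure_eq_dualClosed (by rw [hω, (isClosed_convexDual _).closure_eq])
    rw [e']
    exact (IdentDistrib.of_ae_eq (hid.aemeasurable_fst.congr e.symm) e).trans hid

end Dual

/-! ### The Voronoi cell of the apex in gnomonic coordinates -/

section Geometry

variable {d : ℕ}

local notation "E" => EuclideanSpace ℝ (Fin d)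

/-- The last `d` coordinates of a point of the hyperboloid. -/
def spacePart (z : Hyperboloid d) : E := WithLp.toLp 2 fun i => z.1 i.succ

theorem minkowski_eq_inner (x z : Hyperboloid d) :
    minkowski x.1 z.1 = x.1 0 * z.1 0 - inner ℝ (spacePart x) (spacePart z) := by
  simp [minkowski, spacePart, PiLp.inner_apply, mul_comm]

theorem time_sq (z : Hyperboloid d) : z.1 0 ^ 2 = 1 + ‖spacePart z‖ ^ 2 := by
  have h := z.2.1
  rw [minkowski_eq_inner, real_inner_self_eq_norm_sq] at h
  linarith

theorem time_pos (z : Hyperboloid d) : 0 < z.1 0 := z.2.2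

theorem one_le_time (z : Hyperboloid d) : 1 ≤ z.1 0 := by
  nlinarith [time_sq z, time_pos z, sq_nonneg ‖spacePart z‖]

theorem spacePart_hypParam (y : E) : spacePart (hypParam d y) = y := by
  ext i; simp [spacePart, hypParam, graphMap]

theorem time_hypParam (y : E) : (hypParam d y).1 0 = √(1 + ‖y‖ ^ 2) := by
  simp [hypParam, graphMap]

theorem hypParam_spacePart (z : Hyperboloid d) : hypParam d (spacePart z) = z := by
  refine Subtype.ext ?_
  ext i
  refine Fin.cases ?_ (fun i => ?_) i
  · simp [hypParam, graphMap, ← time_sq, Real.sqrt_sq (time_pos z).le]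
  · simp [hypParam, graphMap, spacePart]

theorem gnomonic_eq (z : Hyperboloid d) : gnomonic z = (z.1 0)⁻¹ • spacePart z := by
  ext i; simp [gnomonic, spacePart, div_eq_inv_mul]

/-- The pole of the bisector of `e` and `z`, in gnomonic coordinates. -/
noncomputable def bisectorPole (z : Hyperboloid d) : E := (z.1 0 - 1)⁻¹ • spacePart z

theorem minkowski_apex (x : Hyperboloid d) : minkowski x.1 (apex d).1 = x.1 0 := by
  simp [minkowski, apex]

/-- Cauchy–Schwarz together with `‖x'‖ < x₀`. Positivity, weaker than `B ≥ 1`, is all that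
`Real.arcosh_le_arcosh` needs below. -/
theorem minkowski_pos (x z : Hyperboloid d) : 0 < minkowski x.1 z.1 := by
  rw [minkowski_eq_inner]
  have h1 := real_inner_le_norm (spacePart x) (spacePart z)
  have hx := time_sq x
  have hz := time_sq z
  have h2 : ‖spacePart x‖ < x.1 0 := by
    refine lt_of_pow_lt_pow_left₀ 2 (time_pos x).le (by linarith)
  have h3 : ‖spacePart z‖ < z.1 0 := by
    refine lt_of_pow_lt_pow_left₀ 2 (time_pos z).le (by linarith)
  have := mul_lt_mul'' h2 h3 (norm_nonneg _) (norm_nonneg _)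
  linarith

theorem hypDist_apex_le_iff (x z : Hyperboloid d) :
    hypDist x (apex d) ≤ hypDist x z ↔ inner ℝ (gnomonic x) (bisectorPole z) ≤ 1 := by
  rw [hypDist, hypDist, Real.arcosh_le_arcosh (minkowski_pos _ _) (minkowski_pos _ _),
    minkowski_apex, minkowski_eq_inner, gnomonic_eq, bisectorPole, inner_smul_left,
    inner_smul_right]
  have hx := time_pos x
  -- If `z₀ = 1`, then `z` is the apex, its pole is `0`, and both sides hold trivially.
  rcases (one_le_time z).eq_or_lt with hz | hz
  · have : spacePart z = 0 := by
      have := time_sq z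
      rw [← hz] at this
      exact norm_eq_zero.1 (pow_eq_zero_iff two_ne_zero |>.1 (by linarith))
    simp [this, ← hz]
  · have hz' : 0 < z.1 0 - 1 := sub_pos.2 hz
    have : (x.1 0)⁻¹ * ((z.1 0 - 1)⁻¹ * inner ℝ (spacePart x) (spacePart z)) =
        inner ℝ (spacePart x) (spacePart z) / (x.1 0 * (z.1 0 - 1)) := by
      field_simp
    simp only [conj_trivial]
    rw [this, div_le_one (by positivity)]
    constructor <;> intro h <;> linarith

theorem norm_gnomonic_lt_one (x : Hyperboloid d) : ‖gnomonic x‖ < 1 := by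
  have hx := time_pos x
  rw [gnomonic_eq, norm_smul, norm_inv, Real.norm_of_nonneg hx.le, inv_mul_lt_one₀ hx]
  exact lt_of_pow_lt_pow_left₀ 2 hx.le (by linarith [time_sq x])

theorem gnomonic_hypParam (v : E) (hv : ‖v‖ < 1) :
    gnomonic (hypParam d ((√(1 - ‖v‖ ^ 2))⁻¹ • v)) = v := by
  have h0 : 0 < 1 - ‖v‖ ^ 2 := by nlinarith [norm_nonneg v]
  have h1 : 1 + ‖(√(1 - ‖v‖ ^ 2))⁻¹ • v‖ ^ 2 = (√(1 - ‖v‖ ^ 2))⁻¹ ^ 2 := by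
    rw [norm_smul, mul_pow, Real.norm_eq_abs, sq_abs, inv_pow, Real.sq_sqrt h0.le]
    field_simp
    ring
  have h2 : 0 < √(1 - ‖v‖ ^ 2) := Real.sqrt_pos.2 h0
  rw [gnomonic_eq, time_hypParam, spacePart_hypParam, h1, Real.sqrt_sq (by positivity), inv_inv,
    smul_smul, mul_inv_cancel₀ h2.ne', one_smul]

theorem gnomonic_image_voronoiCell (S : Set (Hyperboloid d)) :
    gnomonic '' voronoiCell (apex d) (insert (apex d) S) =
      Metric.ball 0 1 ∩ convexDual (bisectorPole '' S) := by
  ext v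
  constructor
  · rintro ⟨x, hx, rfl⟩
    refine ⟨by simpa using norm_gnomonic_lt_one x, ?_⟩
    rintro _ ⟨z, hz, rfl⟩
    exact (hypDist_apex_le_iff x z).1 (hx z (Set.mem_insert_of_mem _ hz))
  · rintro ⟨hv, hS⟩
    rw [mem_ball_zero_iff] at hv
    refine ⟨_, ?_, gnomonic_hypParam v hv⟩
    rintro z (rfl | hz)
    · exact le_rfl
    · rw [hypDist_apex_le_iff, gnomonic_hypParam v hv]
      exact hS _ (Set.mem_image_of_mem _ hz)

theorem convex_convexDual (K : Set E) : Convex ℝ (convexDual K) := by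
  have : convexDual K = ⋂ y ∈ K, {x | inner ℝ x y ≤ 1} := by ext; simp [convexDual]
  rw [this]
  refine convex_iInter₂ fun y _ => ?_
  simp only [real_inner_comm y _]
  exact convex_halfSpace_le (innerₗ E y).isLinear 1

/-- The dual is convex and contains `0`, so each of its points `v` is the limit of `t • v` as `t ↑
1`, and these lie in the open ball. -/
theorem closure_ball_inter_convexDual {K : Set E} (hK : convexDual K ⊆ Metric.closedBall 0 1) :
    closure (Metric.ball 0 1 ∩ convexDual K) = convexDual K := by
  refine Set.Subset.antisymm
    (closure_minimal Set.inter_subset_right (isClosed_convexDual K)) fun v hv => ?_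
  have h0 : (0 : E) ∈ convexDual K := fun y _ => by simp
  have hv1 : ‖v‖ ≤ 1 := by simpa using hK hv
  have hc : Filter.Tendsto (fun t : ℝ => t • v) (nhdsWithin 1 (Set.Iio 1)) (nhds ((1 : ℝ) • v)) :=
    ((continuous_id.smul continuous_const).tendsto (1 : ℝ)).mono_left nhdsWithin_le_nhds
  rw [one_smul] at hc
  refine mem_closure_of_tendsto hc ?_
  filter_upwards [Ioo_mem_nhdsLT (show (0 : ℝ) < 1 by norm_num)] with t ht
  refine ⟨?_, ?_⟩
  · rw [mem_ball_zero_iff, norm_smul, Real.norm_of_nonneg ht.1.le]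
    nlinarith [ht.1, ht.2, norm_nonneg v]
  · exact (convex_convexDual K).smul_mem_of_zero_mem h0 hv ⟨ht.1.le, ht.2.le⟩

/-- The inverse of the map that sends the spatial part of `z` to `bisectorPole z`. -/
noncomputable def poleInv (x : E) : E := (2 / (‖x‖ ^ 2 - 1)) • x

theorem poleInv_bisectorPole (z : Hyperboloid d) : poleInv (bisectorPole z) = spacePart z := by
  rw [poleInv, bisectorPole, smul_smul]
  rcases (one_le_time z).eq_or_lt with hz | hz
  · have : spacePart z = 0 := by
      have := time_sq z
      rw [← hz] at this
      exact norm_eq_zero.1 (pow_eq_zero_iff two_ne_zero |>.1 (by linarith))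
    simp [this]
  · have hz' : 0 < z.1 0 - 1 := sub_pos.2 hz
    -- Since `‖z'‖² = (z₀ - 1)(z₀ + 1)`, the squared norm of the pole is `(z₀ + 1)/(z₀ - 1)`.
    have h : ‖(z.1 0 - 1)⁻¹ • spacePart z‖ ^ 2 - 1 = 2 / (z.1 0 - 1) := by
      rw [norm_smul, mul_pow, Real.norm_eq_abs, sq_abs]
      have : ‖spacePart z‖ ^ 2 = (z.1 0) ^ 2 - 1 := by linarith [time_sq z]
      rw [this]
      field_simp
      ring
    rw [h]
    convert one_smul ℝ (spacePart z) using 2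
    field_simp

theorem injective_bisectorPole : Function.Injective (bisectorPole (d := d)) := fun z w h => by
  rw [← hypParam_spacePart z, ← hypParam_spacePart w, ← poleInv_bisectorPole z,
    ← poleInv_bisectorPole w, h]

theorem measurable_bisectorPole : Measurable (bisectorPole (d := d)) := by
  have h0 (i : Fin (d + 1)) : Measurable fun z : Hyperboloid d => z.1 i :=
    (EuclideanSpace.proj (𝕜 := ℝ) i).continuous.measurable.comp measurable_subtype_coe
  have h1 : Measurable (spacePart (d := d)) :=
    (WithLp.measurable_toLp 2 _).comp (measurable_pi_lambda _ fun i => h0 i.succ)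
  exact ((h0 0).sub_const 1).inv.smul h1

theorem measurable_hypParam : Measurable (hypParam d) := by
  refine Measurable.subtype_mk ((WithLp.measurable_toLp 2 _).comp (measurable_pi_lambda _ ?_))
  refine Fin.cases ?_ fun i => ?_
  · simp only [Fin.cons_zero]; fun_prop
  · simp only [Fin.cons_succ]; fun_prop

/-! ### The hyperbolic volume and the change of variables -/

theorem time_poleInv {x : E} (hx : 1 < ‖x‖) :
    √(1 + ‖poleInv x‖ ^ 2) = (‖x‖ ^ 2 + 1) / (‖x‖ ^ 2 - 1) := by
  have h : 0 < ‖x‖ ^ 2 - 1 := by nlinarith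
  rw [Real.sqrt_eq_iff_mul_self_eq_of_pos (by positivity), poleInv, norm_smul, mul_pow,
    Real.norm_eq_abs, sq_abs]
  field_simp
  ring

theorem bisectorPole_poleInv {x : E} (hx : 1 < ‖x‖) :
    bisectorPole (hypParam d (poleInv x)) = x := by
  have h : 0 < ‖x‖ ^ 2 - 1 := by nlinarith
  rw [bisectorPole, time_hypParam, spacePart_hypParam, time_poleInv hx, poleInv, smul_smul]
  convert one_smul ℝ x using 2
  have : (‖x‖ ^ 2 + 1) / (‖x‖ ^ 2 - 1) - 1 = 2 / (‖x‖ ^ 2 - 1) := by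
    field_simp
    ring
  rw [this]
  field_simp

theorem one_lt_norm_bisectorPole {y : E} (hy : y ≠ 0) : 1 < ‖bisectorPole (hypParam d y)‖ := by
  have hy' : 0 < ‖y‖ := norm_pos_iff.2 hy
  have h1 : 1 < √(1 + ‖y‖ ^ 2) := by
    rw [Real.lt_sqrt (by norm_num)]
    nlinarith
  have h2 : √(1 + ‖y‖ ^ 2) < 1 + ‖y‖ := by
    rw [Real.sqrt_lt' (by positivity)]
    nlinarith
  rw [bisectorPole, time_hypParam, spacePart_hypParam, norm_smul, norm_inv,
    Real.norm_of_nonneg (by linarith), inv_mul_eq_div, one_lt_div (by linarith)]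
  linarith

theorem image_poleInv : poleInv '' {x : E | 1 < ‖x‖} = {0}ᶜ := by
  ext y
  constructor
  · rintro ⟨x, hx : 1 < ‖x‖, rfl⟩ h0
    have h0 : poleInv x = 0 := h0
    have h : 0 < ‖x‖ ^ 2 - 1 := by nlinarith
    rw [poleInv, smul_eq_zero] at h0
    rcases h0 with h0 | h0
    · exact absurd h0 (by positivity)
    · rw [h0, norm_zero] at hx
      linarith
  · intro hy
    exact ⟨_, one_lt_norm_bisectorPole hy, by rw [poleInv_bisectorPole, spacePart_hypParam]⟩

theorem injOn_poleInv : Set.InjOn (poleInv (d := d)) {x : E | 1 < ‖x‖} := fun x hx y hy h => by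
  rw [← bisectorPole_poleInv hx, ← bisectorPole_poleInv hy, h]

/-- The derivative of `poleInv` at `x`. -/
noncomputable def poleInvDeriv (x : E) : E →L[ℝ] E :=
  (2 / (‖x‖ ^ 2 - 1)) • (ContinuousLinearMap.id ℝ E -
    (2 / (‖x‖ ^ 2 - 1)) • (innerSL ℝ x).smulRight x)

theorem hasFDerivAt_poleInv {x : E} (hx : 1 < ‖x‖) :
    HasFDerivAt poleInv (poleInvDeriv x) x := by
  have h : ‖x‖ ^ 2 - 1 ≠ 0 := by nlinarith
  have h1 : HasFDerivAt (fun x : E => ‖x‖ ^ 2 - 1) (2 • (innerSL ℝ x)) x :=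
    (hasStrictFDerivAt_norm_sq x).hasFDerivAt.sub_const 1
  have h2 := ((hasDerivAt_inv h).comp_hasFDerivAt x h1).const_mul 2
  have h3 := h2.smul (hasFDerivAt_id x)
  refine (h3.congr_fderiv ?_).congr_of_eventuallyEq (.of_forall fun y => ?_)
  · ext1 v
    simp [poleInvDeriv, smul_sub, smul_smul, div_eq_mul_inv]
    simp only [← inv_pow]
    module
  · simp [poleInv, div_eq_mul_inv]

/-- The derivative is a scalar times a rank-one perturbation of the identity, whose determinant is
`1 + f(v)`. That factor is negative here because the map reverses the radial direction. -/
theorem abs_det_poleInvDeriv {x : E} (hx : 1 < ‖x‖) :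
    |(poleInvDeriv x).det| =
      (2 / (‖x‖ ^ 2 - 1)) ^ d * ((‖x‖ ^ 2 + 1) / (‖x‖ ^ 2 - 1)) := by
  have h : 0 < ‖x‖ ^ 2 - 1 := by nlinarith
  have h1 : ((poleInvDeriv x : E →L[ℝ] E) : E →ₗ[ℝ] E) = (2 / (‖x‖ ^ 2 - 1)) •
      LinearMap.transvection ((innerSL ℝ x : E →L[ℝ] ℝ) : E →ₗ[ℝ] ℝ)
        (-(2 / (‖x‖ ^ 2 - 1)) • x) := by
    ext1 v
    simp [poleInvDeriv, LinearMap.transvection.apply, smul_smul, sub_eq_add_neg]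
    ring_nf
  rw [ContinuousLinearMap.det, h1, LinearMap.det_smul, LinearMap.transvection.det]
  simp only [finrank_euclideanSpace, Fintype.card_fin, ContinuousLinearMap.coe_coe, map_smul,
    innerSL_apply_apply, real_inner_self_eq_norm_sq, smul_eq_mul]
  have h2 : 1 + -(2 / (‖x‖ ^ 2 - 1)) * ‖x‖ ^ 2 = -((‖x‖ ^ 2 + 1) / (‖x‖ ^ 2 - 1)) := by
    field_simp
    ring
  rw [h2, mul_neg, abs_neg, abs_of_nonneg (by positivity)]

end Geometry

/-! ### The Riemannian density in the graph chart and the image of the Voronoi intensity -/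

section Volume

variable {d : ℕ}

local notation "E" => EuclideanSpace ℝ (Fin d)

theorem hasFDerivAt_graphMap_zero (y : E) :
    HasFDerivAt (fun y => graphMap d y 0) ((√(1 + ‖y‖ ^ 2))⁻¹ • innerSL ℝ y) y := by
  have h : 1 + ‖y‖ ^ 2 ≠ 0 := by positivity
  have h1 := (((hasStrictFDerivAt_norm_sq y).hasFDerivAt.const_add 1).sqrt h)
  refine (h1.congr_fderiv ?_).congr_of_eventuallyEq (.of_forall fun z => ?_)
  · ext1 v
    simp
    ring
  · simp [graphMap]

theorem hasFDerivAt_graphMap_succ (y : E) (i : Fin d) :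
    HasFDerivAt (fun y => graphMap d y i.succ) (EuclideanSpace.proj (𝕜 := ℝ) i : E →L[ℝ] ℝ) y :=
  (EuclideanSpace.proj (𝕜 := ℝ) i : E →L[ℝ] ℝ).hasFDerivAt.congr_of_eventuallyEq
    (.of_forall fun z => by simp [graphMap])

theorem differentiableAt_graphMap (y : E) : DifferentiableAt ℝ (graphMap d) y := by
  rw [differentiableAt_euclidean]
  exact Fin.cases (hasFDerivAt_graphMap_zero y).differentiableAt
    fun i => (hasFDerivAt_graphMap_succ y i).differentiableAt

theorem fderiv_graphMap_zero (y v : E) :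
    fderiv ℝ (graphMap d) y v 0 = (√(1 + ‖y‖ ^ 2))⁻¹ * inner ℝ y v := by
  have h := ((EuclideanSpace.proj (𝕜 := ℝ) (0 : Fin (d + 1))).hasFDerivAt.comp y
    (differentiableAt_graphMap y).hasFDerivAt).unique
    (hasFDerivAt_graphMap_zero y)
  simpa using DFunLike.congr_fun h v

theorem fderiv_graphMap_succ (y v : E) (i : Fin d) :
    fderiv ℝ (graphMap d) y v i.succ = v i := by
  have h := ((EuclideanSpace.proj (𝕜 := ℝ) i.succ).hasFDerivAt.comp y
    (differentiableAt_graphMap y).hasFDerivAt).unique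
    (hasFDerivAt_graphMap_succ y i)
  simpa using DFunLike.congr_fun h v

/-- The metric is `1 - y yᵀ / (1 + ‖y‖²)`, to which the matrix determinant lemma applies. -/
theorem det_metricMatrix (y : E) : (metricMatrix d y).det = (1 + ‖y‖ ^ 2)⁻¹ := by
  have hw : (0 : ℝ) < 1 + ‖y‖ ^ 2 := by positivity
  have h : metricMatrix d y = 1 + Matrix.replicateCol Unit (fun i => -(1 + ‖y‖ ^ 2)⁻¹ * y i) *
      Matrix.replicateRow Unit (fun i => y i) := by
    ext i j
    simp only [metricMatrix, Matrix.of_apply, minkowski, fderiv_graphMap_zero,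
      fderiv_graphMap_succ, Matrix.add_apply, Matrix.mul_apply, Matrix.replicateCol_apply,
      Matrix.replicateRow_apply, Finset.univ_unique, Finset.sum_singleton, Matrix.one_apply,
      EuclideanSpace.inner_single_right, one_mul, conj_trivial]
    have h1 : ∑ k : Fin d, (EuclideanSpace.single i (1 : ℝ) : E) k *
        (EuclideanSpace.single j (1 : ℝ) : E) k = if i = j then 1 else 0 := by
      simp [eq_comm]
    have h2 : (√(1 + ‖y‖ ^ 2))⁻¹ * (√(1 + ‖y‖ ^ 2))⁻¹ = (1 + ‖y‖ ^ 2)⁻¹ := by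
      rw [← mul_inv, Real.mul_self_sqrt hw.le]
    rw [h1]
    linear_combination (-(y i * y j)) * h2
  have h3 : ∑ i, y i * y i = ‖y‖ ^ 2 := by
    rw [EuclideanSpace.real_norm_sq_eq]
    simp [sq]
  have h4 (i : Fin d) : y i * (-(1 + ‖y‖ ^ 2)⁻¹ * y i) = -(1 + ‖y‖ ^ 2)⁻¹ * (y i * y i) := by ring
  rw [h, Matrix.det_one_add_replicateCol_mul_replicateRow, dotProduct]
  simp only [h4]
  rw [← Finset.mul_sum, h3]
  field_simp
  ring

theorem hypVolume_eq :
    hypVolume d = (volume.withDensity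
      fun y : E => ENNReal.ofReal (√(1 + ‖y‖ ^ 2))⁻¹).map (hypParam d) := by
  simp only [hypVolume, det_metricMatrix, Real.sqrt_inv]

theorem sinh_half_arcosh_rpow {w : ℝ} (hw : 1 ≤ w) (γ : ℝ) :
    Real.sinh (Real.arcosh w / 2) ^ (2 * γ) = ((w - 1) / 2) ^ γ := by
  have h0 : 0 ≤ Real.sinh (Real.arcosh w / 2) :=
    Real.sinh_nonneg_iff.2 (by have := Real.arcosh_nonneg hw; positivity)
  have h1 : Real.sinh (Real.arcosh w / 2) ^ 2 = (w - 1) / 2 := by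
    have h := Real.cosh_two_mul (Real.arcosh w / 2)
    rw [mul_div_cancel₀ _ two_ne_zero, Real.cosh_arcosh hw, Real.cosh_sq] at h
    linarith
  rw [Real.rpow_mul h0, Real.rpow_two, h1]

theorem hypDist_apex_left (z : Hyperboloid d) : hypDist (apex d) z = Real.arcosh (z.1 0) := by
  simp [hypDist, minkowski, apex]

theorem voronoiIntensity_eq (lam β : ℝ) :
    voronoiIntensity d lam β = (hypVolume d).withDensity
      fun x => ENNReal.ofReal (lam * ((x.1 0 - 1) / 2) ^ (β - d)) := by
  simp only [voronoiIntensity, hypDist_apex_left, ← mul_sub, sinh_half_arcosh_rpow (one_le_time _)]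

/-- The stationary process is the case `β = d`, where the exponent of `sinh` vanishes. -/
theorem voronoiIntensity_self (lam : ℝ) :
    voronoiIntensity d lam d = ENNReal.ofReal lam • hypVolume d := by
  simp only [voronoiIntensity_eq, sub_self, Real.rpow_zero, mul_one, withDensity_const]

theorem cTilde_pos {β : ℝ} (hβ : 0 < β) (hβ' : (d : ℝ) / 2 < β) : 0 < cTilde d β := by
  have h1 := Real.Gamma_pos_of_pos hβ
  have h2 := Real.Gamma_pos_of_pos (sub_pos.2 hβ')
  have h3 := Real.pi_pos
  rw [cTilde]
  positivity

/-- Under `poleInv` the time coordinate is `(‖x‖² + 1)/(‖x‖² - 1)`, which cancels against the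
Jacobian, and `(z₀ - 1)/2` becomes `(‖x‖² - 1)⁻¹`. The exponents `d` and `β - d` then add up to `β`.
-/
theorem density_identity {lam β : ℝ} {x : E} (hx : 1 < ‖x‖) :
    (2 / (‖x‖ ^ 2 - 1)) ^ d * ((‖x‖ ^ 2 + 1) / (‖x‖ ^ 2 - 1)) *
      ((√(1 + ‖poleInv x‖ ^ 2))⁻¹ * (lam * ((√(1 + ‖poleInv x‖ ^ 2) - 1) / 2) ^ (β - d))) =
    2 ^ d * lam / (‖x‖ ^ 2 - 1) ^ β := by
  have h : 0 < ‖x‖ ^ 2 - 1 := by nlinarith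
  have h1 : ((‖x‖ ^ 2 + 1) / (‖x‖ ^ 2 - 1) - 1) / 2 = (‖x‖ ^ 2 - 1)⁻¹ := by
    field_simp
    ring
  rw [time_poleInv hx, h1, Real.inv_rpow h.le, Real.rpow_sub h, Real.rpow_natCast, div_pow]
  have h2 : 0 < (‖x‖ ^ 2 - 1) ^ β := Real.rpow_pos_of_pos h β
  field_simp

theorem betaStarIntensity_eq {lam β : ℝ} (hc : cTilde d β ≠ 0) :
    betaStarIntensity d (2 ^ d * lam / cTilde d β) β =
      (volume.restrict {x : E | 1 < ‖x‖}).withDensity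
        fun x => ENNReal.ofReal (2 ^ d * lam / (‖x‖ ^ 2 - 1) ^ β) := by
  simp only [betaStarIntensity, div_mul_cancel₀ _ hc]

theorem measurableSet_one_lt_norm : MeasurableSet {x : E | 1 < ‖x‖} :=
  (isOpen_lt continuous_const continuous_norm).measurableSet

theorem map_bisectorPole_voronoiIntensity (hd : 1 ≤ d) {lam β : ℝ} (hc : cTilde d β ≠ 0) :
    (voronoiIntensity d lam β).map bisectorPole =
      betaStarIntensity d (2 ^ d * lam / cTilde d β) β := by
  have : Nonempty (Fin d) := ⟨⟨0, hd⟩⟩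
  have hm0 : Measurable fun z : Hyperboloid d => z.1 0 :=
    (EuclideanSpace.proj (𝕜 := ℝ) 0).continuous.measurable.comp measurable_subtype_coe
  have hb : Measurable fun x : Hyperboloid d =>
      ENNReal.ofReal (lam * ((x.1 0 - 1) / 2) ^ (β - d)) :=
    ((((hm0.sub_const 1).div_const 2).pow_const _).const_mul lam).ennreal_ofReal
  have ha : Measurable fun y : E => ENNReal.ofReal (√(1 + ‖y‖ ^ 2))⁻¹ := by fun_prop
  ext A hA
  have hA1 := measurable_bisectorPole hA
  have hA2 := measurable_hypParam hA1
  rw [betaStarIntensity_eq hc, Measure.map_apply measurable_bisectorPole hA, voronoiIntensity_eq,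
    withDensity_apply _ hA1, hypVolume_eq, setLIntegral_map hA1 hb measurable_hypParam,
    setLIntegral_withDensity_eq_setLIntegral_mul (g := fun y => ENNReal.ofReal
      (lam * (((hypParam d y).1 0 - 1) / 2) ^ (β - d))) _ ha (hb.comp measurable_hypParam) hA2,
    withDensity_apply _ hA, ← lintegral_indicator hA2, ← lintegral_indicator hA]
  -- The image of `poleInv` omits the origin, which is a null set because `d ≥ 1`.
  have hnull : (volume : Measure E).restrict {0}ᶜ = volume :=
    Measure.restrict_eq_self_of_ae_mem (by simp [ae_iff])
  nth_rewrite 1 [← hnull]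
  rw [← image_poleInv, lintegral_image_eq_lintegral_abs_det_fderiv_mul _
    measurableSet_one_lt_norm (fun x hx => (hasFDerivAt_poleInv hx).hasFDerivWithinAt)
    injOn_poleInv]
  refine setLIntegral_congr_fun measurableSet_one_lt_norm fun x hx => ?_
  have hx : 1 < ‖x‖ := hx
  have h : 0 < ‖x‖ ^ 2 - 1 := by nlinarith
  simp only [abs_det_poleInvDeriv hx]
  by_cases hxA : x ∈ A
  · rw [Set.indicator_of_mem hxA, Set.indicator_of_mem
      (by simpa only [Set.mem_preimage, bisectorPole_poleInv hx] using hxA), ← density_identity hx]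
    simp only [Pi.mul_apply, time_hypParam]
    rw [← ENNReal.ofReal_mul (by positivity), ← ENNReal.ofReal_mul (by positivity)]
  · rw [Set.indicator_of_notMem hxA, Set.indicator_of_notMem
      (by simpa only [Set.mem_preimage, bisectorPole_poleInv hx] using hxA), mul_zero]

end Volume

/-! ### Boundedness of the dual of the beta-star set -/

section Bounded

open scoped Pointwise

variable {d : ℕ}

local notation "E" => EuclideanSpace ℝ (Fin d)

/-- The measure on `{‖x‖ > 1}` with Lebesgue density `κ (‖x‖² - 1)^{-β}`. -/
noncomputable def powerIntensity (d : ℕ) (κ β : ℝ) : Measure (EuclideanSpace ℝ (Fin d)) :=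
  (volume.restrict {x | 1 < ‖x‖}).withDensity
    fun x => ENNReal.ofReal (κ / (‖x‖ ^ 2 - 1) ^ β)

theorem powerIntensity_compl (κ β : ℝ) : powerIntensity d κ β {x : E | 1 < ‖x‖}ᶜ = 0 :=
  withDensity_absolutelyContinuous _ _
    (by rw [Measure.restrict_apply measurableSet_one_lt_norm.compl, Set.compl_inter_self,
      measure_empty])

theorem le_powerIntensity {κ β : ℝ} {Q : Set E} (hQ : MeasurableSet Q)
    (hQ1 : Q ⊆ {x | 1 < ‖x‖}) {c : ℝ} (hc : ∀ x ∈ Q, c ≤ κ / (‖x‖ ^ 2 - 1) ^ β) :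
    ENNReal.ofReal c * volume Q ≤ powerIntensity d κ β Q := by
  rw [powerIntensity, withDensity_apply _ hQ, Measure.restrict_restrict hQ,
    Set.inter_eq_left.2 hQ1, ← setLIntegral_const]
  exact setLIntegral_mono' hQ fun x hx => ENNReal.ofReal_le_ofReal (hc x hx)

/-- The points `x` with `1 < ‖x‖ ≤ 1 + δ` whose direction is in the ball of radius `r` at `u`. -/
def shell (u : E) (r δ : ℝ) : Set E :=
  {x | 1 < ‖x‖ ∧ ‖x‖ ≤ 1 + δ ∧ ‖x‖⁻¹ • x ∈ Metric.ball u r}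

/-- The points of the closed unit ball whose direction is in the ball of radius `r` at `u`. -/
def sector (u : E) (r : ℝ) : Set E := {x | ‖x‖ ≤ 1 ∧ ‖x‖⁻¹ • x ∈ Metric.ball u r}

theorem measurable_direction : Measurable fun x : E => ‖x‖⁻¹ • x :=
  measurable_norm.inv.smul measurable_id

theorem measurableSet_shell (u : E) (r δ : ℝ) : MeasurableSet (shell u r δ) := by
  have h : shell u r δ = {x | 1 < ‖x‖} ∩ ({x | ‖x‖ ≤ 1 + δ} ∩
    (fun x => ‖x‖⁻¹ • x) ⁻¹' Metric.ball u r) := rfl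
  rw [h]
  exact measurableSet_one_lt_norm.inter ((measurableSet_le measurable_norm measurable_const).inter
    (measurable_direction Metric.isOpen_ball.measurableSet))

theorem volume_sector_pos {u : E} (hu : ‖u‖ = 1) {r : ℝ} (hr : 0 < r) :
    0 < volume (sector u r) := by
  refine Measure.measure_pos_of_mem_nhds volume (x := (1 / 2 : ℝ) • u) ?_
  have hn : ‖(1 / 2 : ℝ) • u‖ = 1 / 2 := by rw [norm_smul, hu]; norm_num
  have hc : ContinuousAt (fun x : E => ‖x‖⁻¹ • x) ((1 / 2 : ℝ) • u) :=
    (continuous_norm.continuousAt.inv₀ (by rw [hn]; norm_num)).smul continuousAt_id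
  have h1 : ∀ᶠ x in nhds ((1 / 2 : ℝ) • u), ‖x‖⁻¹ • x ∈ Metric.ball u r := by
    refine hc.eventually_mem (Metric.isOpen_ball.mem_nhds ?_)
    rw [hn, smul_smul]
    norm_num [hr]
  have h2 : ∀ᶠ x in nhds ((1 / 2 : ℝ) • u), ‖x‖ < 1 :=
    continuous_norm.continuousAt.eventually_lt continuousAt_const (by rw [hn]; norm_num)
  filter_upwards [h1, h2] with x hx1 hx2
  exact ⟨hx2.le, hx1⟩

theorem volume_sector_ne_top (u : E) (r : ℝ) : volume (sector u r) ≠ ∞ :=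
  ((measure_mono fun _ hx => mem_closedBall_zero_iff.2 hx.1).trans_lt
    (measure_closedBall_lt_top (x := (0 : E)) (r := 1))).ne

theorem smul_sector_diff (u : E) (r : ℝ) {δ : ℝ} (hδ : 0 < δ) :
    (1 + δ) • sector u r \ sector u r ⊆ shell u r δ := by
  rintro _ ⟨⟨x, hx, rfl⟩, hx'⟩
  have h1 : 0 < 1 + δ := by linarith
  have hn : ‖(1 + δ) • x‖ = (1 + δ) * ‖x‖ := by rw [norm_smul, Real.norm_of_nonneg h1.le]
  have hdir : ‖(1 + δ) • x‖⁻¹ • (1 + δ) • x = ‖x‖⁻¹ • x := by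
    rw [hn, smul_smul]
    congr 1
    field_simp
  have hmem : ‖(1 + δ) • x‖⁻¹ • (1 + δ) • x ∈ Metric.ball u r := by rw [hdir]; exact hx.2
  refine ⟨?_, ?_, hmem⟩
  · by_contra h
    exact hx' ⟨not_lt.1 h, hmem⟩
  · dsimp only
    rw [hn]
    nlinarith [hx.1]

theorem le_volume_shell (hd : 1 ≤ d) (u : E) (r : ℝ) {δ : ℝ} (hδ : 0 < δ) :
    ENNReal.ofReal δ * volume (sector u r) ≤ volume (shell u r δ) := by
  refine le_trans ?_ (measure_mono (smul_sector_diff u r hδ))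
  refine le_trans ?_ le_measure_sdiff
  rw [Measure.addHaar_smul_of_nonneg _ (by linarith : (0 : ℝ) ≤ 1 + δ)]
  refine ENNReal.le_sub_of_add_le_right (volume_sector_ne_top u r) ?_
  rw [← one_mul (volume (sector u r)), ← mul_assoc, ← mul_assoc, ← add_mul, mul_one, mul_one]
  gcongr
  rw [← ENNReal.ofReal_one, ← ENNReal.ofReal_add hδ.le zero_le_one]
  refine ENNReal.ofReal_le_ofReal ?_
  rw [finrank_euclideanSpace, Fintype.card_fin, add_comm]
  exact le_self_pow₀ (by linarith) (by lia)

/-- The shell has volume at least `δ` times that of the sector and density at least `κ/(3δ)`, so the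
bound does not depend on `δ`. The condition `δ ≤ 1/3` gives `‖x‖² - 1 ≤ 2δ + δ² ≤ 3δ ≤ 1`, so that
raising to a power `β ≥ 1` does not increase it. -/
theorem le_powerIntensity_shell (hd : 1 ≤ d) {κ β : ℝ} (hκ : 0 < κ) (hβ : 1 ≤ β) (u : E) (r : ℝ)
    {δ : ℝ} (hδ : 0 < δ) (hδ1 : δ ≤ 1 / 3) :
    ENNReal.ofReal (κ / 3) * volume (sector u r) ≤ powerIntensity d κ β (shell u r δ) := by
  refine le_trans ?_ (le_powerIntensity (c := κ / (3 * δ)) (measurableSet_shell u r δ)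
    (fun x hx => hx.1) fun x hx => ?_)
  · refine le_trans ?_ (mul_le_mul_right (le_volume_shell hd u r hδ) _)
    rw [← mul_assoc, ← ENNReal.ofReal_mul (by positivity)]
    refine le_of_eq ?_
    congr 2
    field_simp
  · obtain ⟨h1, h2, -⟩ := hx
    have h3 : 0 < ‖x‖ ^ 2 - 1 := by nlinarith
    have h4 : ‖x‖ ^ 2 - 1 ≤ 3 * δ := by nlinarith
    have h5 : (‖x‖ ^ 2 - 1) ^ β ≤ ‖x‖ ^ 2 - 1 := by
      simpa using Real.rpow_le_rpow_of_exponent_ge h3 (by linarith) hβ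
    exact div_le_div_of_nonneg_left hκ.le (Real.rpow_pos_of_pos h3 β) (h5.trans h4)

theorem shell_subset_ball (u : E) {r δ : ℝ} (hδ : δ ≤ r) :
    shell u r δ ⊆ Metric.ball u (2 * r) := by
  rintro x ⟨h1, h2, h3⟩
  rw [mem_ball_iff_norm] at h3 ⊢
  have hx : ‖x - ‖x‖⁻¹ • x‖ = ‖x‖ - 1 := by
    have h : x - ‖x‖⁻¹ • x = (1 - ‖x‖⁻¹) • x := by rw [sub_smul, one_smul]
    have h0 : 0 < ‖x‖ := by linarith
    rw [h, norm_smul, Real.norm_of_nonneg (sub_nonneg.2 (inv_le_one_of_one_le₀ h1.le))]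
    field_simp
  have := norm_sub_le_norm_sub_add_norm_sub x (‖x‖⁻¹ • x) u
  linarith

/-- If `β ≥ 1` then all open sets that meet the unit sphere have infinite measure. -/
theorem powerIntensity_eq_top (hd : 1 ≤ d) {κ β : ℝ} (hκ : 0 < κ) (hβ : 1 ≤ β) {U : Set E}
    (hU : IsOpen U) {u : E} (huU : u ∈ U) (hu : ‖u‖ = 1) : powerIntensity d κ β U = ∞ := by
  obtain ⟨s, hs, hsU⟩ := Metric.isOpen_iff.1 hU u huU
  set r : ℝ := min (s / 2) (1 / 3) with hr
  have hr0 : 0 < r := by positivity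
  have hrs : 2 * r ≤ s := by linarith [min_le_left (s / 2) (1 / 3 : ℝ)]
  have hr3 : r ≤ 1 / 3 := min_le_right _ _
  have hδ (n : ℕ) : 0 < r / (n + 1) := by positivity
  have hδr (n : ℕ) : r / (n + 1) ≤ r := div_le_self hr0.le (by simp)
  -- If the measure were finite, continuity from above along shells decreasing to `∅` would
  -- contradict their uniform positive lower bound.
  by_contra htop
  have hanti : Antitone fun n : ℕ => shell u r (r / (n + 1)) := by
    intro m n hmn x hx
    refine ⟨hx.1, hx.2.1.trans ?_, hx.2.2⟩
    gcongr
  have hfin : powerIntensity d κ β (shell u r (r / ((0 : ℕ) + 1))) ≠ ∞ :=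
    ne_top_of_le_ne_top htop (measure_mono
      ((shell_subset_ball u (hδr 0)).trans ((Metric.ball_subset_ball hrs).trans hsU)))
  have hlim := tendsto_measure_iInter_atTop (μ := powerIntensity d κ β)
    (fun n : ℕ => (measurableSet_shell u r (r / (n + 1))).nullMeasurableSet) hanti ⟨0, hfin⟩
  have hempty : ⋂ n : ℕ, shell u r (r / (n + 1)) = ∅ := by
    refine Set.eq_empty_of_forall_notMem fun x hx => ?_
    rw [Set.mem_iInter] at hx
    have hl : Filter.Tendsto (fun n : ℕ => 1 + r / ((n : ℝ) + 1)) Filter.atTop (nhds (1 + 0)) :=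
      tendsto_const_nhds.add
        (tendsto_const_nhds.div_atTop (Filter.tendsto_atTop_add_const_right _ _
          tendsto_natCast_atTop_atTop))
    have := ge_of_tendsto' hl fun n => (hx n).2.1
    linarith [(hx 0).1]
  rw [hempty, measure_empty] at hlim
  have hge := ge_of_tendsto' hlim fun n =>
    le_powerIntensity_shell hd hκ hβ u r (hδ n) ((hδr n).trans hr3)
  have hpos : 0 < ENNReal.ofReal (κ / 3) * volume (sector u r) :=
    ENNReal.mul_pos (by simpa using hκ) (volume_sector_pos hu hr0).ne'
  exact absurd hge (not_le.2 hpos)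

/-- A countable basis lets one null set serve all `u` and `V` at once. -/
theorem ae_nonempty_inter_of_isOpen {Ω : Type*} [MeasurableSpace Ω] {P : Measure Ω}
    {ζ : Ω → Set E} {κ β : ℝ} (hd : 1 ≤ d) (hκ : 0 < κ) (hβ : 1 ≤ β)
    (h : IsPoissonProcess P (powerIntensity d κ β) ζ) :
    ∀ᵐ ω ∂P, ∀ u : E, ‖u‖ = 1 → ∀ V : Set E, IsOpen V → u ∈ V → (ζ ω ∩ V).Nonempty := by
  have hb : ∀ᵐ ω ∂P, ∀ U ∈ countableBasis E, (∃ u ∈ U, ‖u‖ = 1) → (ζ ω ∩ U).Nonempty := by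
    rw [ae_ball_iff (countable_countableBasis E)]
    intro U hU
    have hUo := isOpen_of_mem_countableBasis hU
    by_cases hex : ∃ u ∈ U, ‖u‖ = 1
    · obtain ⟨u, huU, hu⟩ := hex
      filter_upwards [h.ae_nonempty_inter hUo.measurableSet
        (powerIntensity_eq_top hd hκ hβ hUo huU hu)] with ω hω _ using hω
    · exact .of_forall fun ω hω => absurd hω hex
  filter_upwards [hb] with ω hω u hu V hV huV
  obtain ⟨U, hU, huU, hUV⟩ := (isBasis_countableBasis E).exists_subset_of_mem_open huV hV
  exact (hω U hU ⟨u, huU, hu⟩).mono (Set.inter_subset_inter_right _ hUV)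

/-- If `‖v‖ > 1`, the open half-space `⟨v, x⟩ > 1` contains the unit vector `v/‖v‖`, hence a point
of the process, which excludes `v` from the dual. -/
theorem ae_convexDual_subset_closedBall {Ω : Type*} [MeasurableSpace Ω] {P : Measure Ω}
    {ζ : Ω → Set E} {κ β : ℝ} (hd : 1 ≤ d) (hκ : 0 < κ) (hβ : 1 ≤ β)
    (h : IsPoissonProcess P (powerIntensity d κ β) ζ) :
    ∀ᵐ ω ∂P, convexDual (ζ ω) ⊆ Metric.closedBall 0 1 := by
  filter_upwards [ae_nonempty_inter_of_isOpen hd hκ hβ h] with ω hω v hv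
  rw [mem_closedBall_zero_iff]
  by_contra! hv1
  have h0 : 0 < ‖v‖ := by linarith
  obtain ⟨x, hx, hvx⟩ := hω (‖v‖⁻¹ • v) (by rw [norm_smul, norm_inv, norm_norm]; field_simp)
    {x | 1 < inner ℝ v x} (isOpen_lt continuous_const (by fun_prop)) (by
      rw [Set.mem_ofPred_eq, inner_smul_right, real_inner_self_eq_norm_sq]
      field_simp
      exact hv1)
  exact absurd (hv x hx) (not_le.2 hvx)

end Bounded

/-! ### The dual of the beta-star set does not reach the unit sphere if `β = d` -/

section Sphere

/-- A box of width `δ²` in the direction `0` and `δ` in all others, outside the unit ball. -/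
theorem exists_box {n : ℕ} (hn : 1 ≤ n) {κ : ℝ} (hκ : 0 < κ) {m : ℝ} (hm : 4 ≤ m)
    {q : EuclideanSpace ℝ (Fin (n + 1))} (hq : ‖q‖ = 1) :
    ∃ Q : Set (EuclideanSpace ℝ (Fin (n + 1))), MeasurableSet Q ∧
      ENNReal.ofReal (κ * (2 / (n + 1)) ^ n / 10 ^ (n + 1) * m) ≤
        powerIntensity (n + 1) κ ((n + 1 : ℕ) : ℝ) Q ∧
      ∀ u, ‖u - q‖ ≤ (m ^ 2)⁻¹ → ∀ x ∈ Q, 1 < inner ℝ u x := by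
  have hm0 : 0 < m := by linarith
  obtain ⟨b, hb⟩ := Orthonormal.exists_orthonormalBasis_extension_of_card_eq (𝕜 := ℝ)
    (E := EuclideanSpace ℝ (Fin (n + 1))) (ι := Fin (n + 1)) (by simp) (v := fun _ => q) (s := {0})
    (by
      rw [orthonormal_iff_ite]
      rintro ⟨i, rfl⟩ ⟨j, rfl⟩
      simp [hq])
  have hb0 : b 0 = q := hb 0 rfl
  set ε : ℝ := (m ^ 2)⁻¹ with hε
  set s : ℝ := m⁻¹ / (n + 1) with hs
  have hε0 : 0 < ε := by positivity
  have hs0 : 0 < s := by positivity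
  have hε1 : ε ≤ 1 / 16 := by
    rw [hε, one_div]
    exact inv_anti₀ (by norm_num) (by nlinarith)
  have hsε : (n : ℝ) * s ^ 2 ≤ ε := by
    have : (n : ℝ) * s ^ 2 = ε * (n / (n + 1) ^ 2) := by rw [hs, hε]; field_simp
    rw [this]
    refine mul_le_of_le_one_right hε0.le ((div_le_one (by positivity)).2 ?_)
    nlinarith [(Nat.cast_nonneg n : (0 : ℝ) ≤ n)]
  -- The offset `3ε` exceeds the loss `‖u - q‖ ‖x‖ ≤ 2ε` incurred on replacing `q` by `u`.
  let I : Fin (n + 1) → Set ℝ :=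
    Fin.cons (Set.Ioo (1 + 3 * ε) (1 + 4 * ε)) fun _ => Set.Ioo (-s) s
  let Q : Set (EuclideanSpace ℝ (Fin (n + 1))) := (WithLp.ofLp ∘ b.repr) ⁻¹' Set.univ.pi I
  have hI : MeasurableSet (Set.univ.pi I) :=
    MeasurableSet.univ_pi (Fin.cases measurableSet_Ioo fun _ => measurableSet_Ioo)
  have hmp := (PiLp.volume_preserving_ofLp (Fin (n + 1))).comp b.measurePreserving_repr
  have hQ : MeasurableSet Q := hmp.measurable hI
  have hvol : volume Q = ENNReal.ofReal (ε * (2 * s) ^ n) := by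
    rw [hmp.measure_preimage hI.nullMeasurableSet, volume_pi_pi, Fin.prod_univ_succ]
    simp only [I, Fin.cons_zero, Fin.cons_succ, Real.volume_Ioo, Finset.prod_const,
      Finset.card_univ, Fintype.card_fin]
    rw [← ENNReal.ofReal_pow (by linarith), ← ENNReal.ofReal_mul (by linarith)]
    congr 1
    ring
  have hmem0 : ∀ x ∈ Q, inner ℝ q x ∈ Set.Ioo (1 + 3 * ε) (1 + 4 * ε) := by
    intro x hx
    have := hx 0 trivial
    simpa [I, b.repr_apply_apply, hb0] using this
  have hnorm : ∀ x ∈ Q, ‖x‖ ^ 2 ≤ 1 + 10 * ε := by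
    intro x hx
    have h0 := hmem0 x hx
    rw [← b.repr.norm_map x, EuclideanSpace.real_norm_sq_eq, Fin.sum_univ_succ]
    have h1 : ∑ i : Fin n, b.repr x i.succ ^ 2 ≤ n * s ^ 2 := by
      refine (Finset.sum_le_card_nsmul _ _ (s ^ 2) fun i _ => ?_).trans (by simp)
      have hi : b.repr x i.succ ∈ Set.Ioo (-s) s := hx i.succ trivial
      exact sq_le_sq' hi.1.le hi.2.le
    have h2 : b.repr x 0 = inner ℝ q x := by rw [b.repr_apply_apply, hb0]
    -- Here `(1 + 4ε)² + ε ≤ 1 + 10ε`, since `ε ≤ 1/16`.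
    rw [h2]
    nlinarith [h0.1, h0.2]
  have hone : ∀ x ∈ Q, 1 < ‖x‖ := by
    intro x hx
    have h1 := real_inner_le_norm q x
    rw [hq, one_mul] at h1
    linarith [(hmem0 x hx).1]
  refine ⟨Q, hQ, ?_, fun u hu x hx => ?_⟩
  · refine le_trans ?_ (le_powerIntensity (c := κ / (10 * ε) ^ (n + 1)) hQ hone fun x hx => ?_)
    · rw [hvol, ← ENNReal.ofReal_mul (by positivity)]
      refine ENNReal.ofReal_le_ofReal ?_
      have h1 : κ / (10 * ε) ^ (n + 1) * (ε * (2 * s) ^ n) =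
          κ * (2 / (n + 1)) ^ n / 10 ^ (n + 1) * m ^ n := by
        have h2 : 2 * s = 2 / (n + 1) * m⁻¹ := by rw [hs]; ring
        rw [h2, mul_pow, mul_pow, pow_succ ε, hε]
        simp only [inv_pow]
        field_simp
        ring
      rw [h1]
      gcongr
      exact le_self_pow₀ (by linarith) (by lia)
    · have h1 := hone x hx
      have h2 : 0 < ‖x‖ ^ 2 - 1 := by nlinarith
      rw [Real.rpow_natCast]
      gcongr
      linarith [hnorm x hx]
  · have h1 : ‖x‖ ≤ 2 := by
      refine le_of_sq_le_sq ?_ (by norm_num)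
      linarith [hnorm x hx]
    have h2 : inner ℝ u x = inner ℝ q x + inner ℝ (u - q) x := by rw [inner_sub_left]; ring
    have h3 : -inner ℝ (u - q) x ≤ ‖u - q‖ * ‖x‖ :=
      (neg_le_abs _).trans (abs_real_inner_le_norm _ _)
    have h4 : ‖u - q‖ * ‖x‖ ≤ ε * 2 := mul_le_mul hu h1 (norm_nonneg _) hε0.le
    linarith [(hmem0 x hx).1]

/-- Vectors with the same integer parts of `N u` are close to each other. -/
theorem norm_sub_le_of_floor_eq {d : ℕ} {N : ℝ} (hN : 0 < N) {u v : EuclideanSpace ℝ (Fin d)}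
    (h : ∀ i, ⌊N * u i⌋ = ⌊N * v i⌋) : ‖u - v‖ ≤ d / N := by
  refine le_of_sq_le_sq ?_ (by positivity)
  rw [EuclideanSpace.real_norm_sq_eq]
  have h1 (i : Fin d) : (u - v) i ^ 2 ≤ (N⁻¹) ^ 2 := by
    have h2 := Int.abs_sub_lt_one_of_floor_eq_floor (h i)
    rw [← mul_sub, abs_mul, abs_of_pos hN] at h2
    refine sq_le_sq.2 ?_
    rw [abs_of_pos (inv_pos.2 hN), PiLp.sub_apply, ← one_div, le_div_iff₀ hN]
    linarith
  refine (Finset.sum_le_card_nsmul _ _ _ fun i _ => h1 i).trans ?_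
  rw [Finset.card_univ, Fintype.card_fin, nsmul_eq_mul, div_pow, inv_pow, div_eq_mul_inv]
  gcongr
  exact_mod_cast Nat.le_self_pow two_ne_zero d

/-- A union bound over a cubic grid. One box excludes every `u` in a grid cell, so the event for
that cell lies in a single void event. The event of hitting the sphere need not be shown measurable,
as only monotonicity and subadditivity are used. -/
theorem measure_hit_sphere_le {n : ℕ} (hn : 1 ≤ n) {κ : ℝ} (hκ : 0 < κ) {Ω : Type*}
    [MeasurableSpace Ω] {P : Measure Ω} {ζ : Ω → Set (EuclideanSpace ℝ (Fin (n + 1)))}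
    (h : IsPoissonProcess P (powerIntensity (n + 1) κ ((n + 1 : ℕ) : ℝ)) ζ) {m : ℕ} (hm : 4 ≤ m) :
    P {ω | ∃ u ∈ convexDual (ζ ω), ‖u‖ = 1} ≤
      ENNReal.ofReal ((2 * ((n + 1) * m ^ 2) + 1) ^ (n + 1) *
        Real.exp (-(κ * (2 / (n + 1)) ^ n / 10 ^ (n + 1) * m))) := by
  have hm4 : (4 : ℝ) ≤ m := by exact_mod_cast hm
  -- With this mesh, points of one cell are within `(n + 1)/N = m⁻²`, the tolerance in `exists_box`.
  set N : ℕ := (n + 1) * m ^ 2 with hN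
  have hN0 : 0 < (N : ℝ) := by
    rw [hN]
    push_cast
    positivity
  let G : Finset (Fin (n + 1) → ℤ) := Fintype.piFinset fun _ => Finset.Icc (-(N : ℤ)) N
  have hcard : (G.card : ℝ) = (2 * ((n + 1) * m ^ 2) + 1) ^ (n + 1) := by
    have h1 : G.card = (2 * N + 1) ^ (n + 1) := by
      rw [Fintype.card_piFinset_const, Int.card_Icc]
      congr 1
      lia
    rw [h1, hN]
    push_cast
    ring
  have hcover : {ω | ∃ u ∈ convexDual (ζ ω), ‖u‖ = 1} ⊆
      ⋃ k ∈ G, {ω | ∃ u ∈ convexDual (ζ ω), ‖u‖ = 1 ∧ ∀ i, ⌊(N : ℝ) * u i⌋ = k i} := by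
    rintro ω ⟨u, hu, hu1⟩
    refine Set.mem_iUnion₂.2 ⟨fun i => ⌊(N : ℝ) * u i⌋, ?_, u, hu, hu1, fun _ => rfl⟩
    refine Fintype.mem_piFinset.2 fun i => Finset.mem_Icc.2 ?_
    have hui : |u i| ≤ 1 := by
      have := PiLp.norm_apply_le u i
      rwa [hu1, Real.norm_eq_abs] at this
    obtain ⟨h1, h2⟩ := abs_le.1 hui
    constructor
    · rw [Int.le_floor]
      push_cast
      nlinarith
    · have h3 : (⌊(N : ℝ) * u i⌋ : ℝ) ≤ N := (Int.floor_le _).trans (by nlinarith)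
      exact_mod_cast h3
  have hcell : ∀ k ∈ G,
      P {ω | ∃ u ∈ convexDual (ζ ω), ‖u‖ = 1 ∧ ∀ i, ⌊(N : ℝ) * u i⌋ = k i} ≤
        ENNReal.ofReal (Real.exp (-(κ * (2 / (n + 1)) ^ n / 10 ^ (n + 1) * m))) := by
    intro k _
    by_cases hex : ∃ q : EuclideanSpace ℝ (Fin (n + 1)), ‖q‖ = 1 ∧ ∀ i, ⌊(N : ℝ) * q i⌋ = k i
    · obtain ⟨q, hq, hqk⟩ := hex
      obtain ⟨Q, hQ, hQμ, hQu⟩ := exists_box hn hκ hm4 hq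
      refine (measure_mono ?_).trans (h.void_le hQ hQμ)
      rintro ω ⟨u, hu, -, huk⟩
      refine Set.eq_empty_of_forall_notMem fun x hx => ?_
      have hclose : ‖u - q‖ ≤ ((m : ℝ) ^ 2)⁻¹ := by
        refine (norm_sub_le_of_floor_eq hN0 fun i => (huk i).trans (hqk i).symm).trans (le_of_eq ?_)
        rw [hN]
        push_cast
        field_simp
      exact absurd (hu x hx.1) (not_le.2 (hQu u hclose x hx.2))
    · have hempty : {ω | ∃ u ∈ convexDual (ζ ω), ‖u‖ = 1 ∧ ∀ i, ⌊(N : ℝ) * u i⌋ = k i} = ∅ :=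
        Set.eq_empty_of_forall_notMem fun ω ⟨u, _, hu⟩ => hex ⟨u, hu⟩
      rw [hempty, measure_empty]
      exact zero_le
  refine (measure_mono hcover).trans ((measure_biUnion_finset_le _ _).trans
    ((Finset.sum_le_card_nsmul _ _ _ hcell).trans (le_of_eq ?_)))
  rw [← hcard, ENNReal.ofReal_mul (by positivity), ENNReal.ofReal_natCast, nsmul_eq_mul]

theorem tendsto_pow_mul_exp_neg_mul {a c : ℝ} (hc : 0 < c) (ha : 0 ≤ a) (k : ℕ) :
    Filter.Tendsto (fun m : ℕ => (2 * (a * (m : ℝ) ^ 2) + 1) ^ k * Real.exp (-(c * m)))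
      Filter.atTop (nhds 0) := by
  have h1 : Filter.Tendsto (fun m : ℕ => c * (m : ℝ)) Filter.atTop Filter.atTop :=
    tendsto_natCast_atTop_atTop.const_mul_atTop hc
  have h2 := ((Real.tendsto_pow_mul_exp_neg_atTop_nhds_zero (2 * k)).comp h1).const_mul
    ((2 * a + 1) ^ k / c ^ (2 * k))
  rw [mul_zero] at h2
  refine squeeze_zero' (.of_forall fun m => by positivity) ?_ h2
  filter_upwards [Filter.eventually_ge_atTop 1] with m hm
  have hm1 : (1 : ℝ) ≤ m := by exact_mod_cast hm
  have h3 : (2 * (a * (m : ℝ) ^ 2) + 1) ^ k ≤ ((2 * a + 1) * (m : ℝ) ^ 2) ^ k := by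
    refine pow_le_pow_left₀ (by positivity) ?_ k
    nlinarith
  refine (mul_le_mul_of_nonneg_right h3 (Real.exp_pos _).le).trans (le_of_eq ?_)
  simp only [Function.comp_apply]
  rw [mul_pow, mul_pow, ← pow_mul]
  field_simp

theorem ae_convexDual_subset_ball {d : ℕ} (hd : 1 ≤ d) {κ : ℝ} (hκ : 0 < κ) {Ω : Type*}
    [MeasurableSpace Ω] {P : Measure Ω} [IsProbabilityMeasure P]
    {ζ : Ω → Set (EuclideanSpace ℝ (Fin d))}
    (h : IsPoissonProcess P (powerIntensity d κ (d : ℝ)) ζ) :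
    ∀ᵐ ω ∂P, convexDual (ζ ω) ⊆ Metric.ball 0 1 := by
  have hd1 : (1 : ℝ) ≤ d := by exact_mod_cast hd
  suffices hs : ∀ᵐ ω ∂P, ∀ u ∈ convexDual (ζ ω), ‖u‖ ≠ 1 by
    filter_upwards [hs, ae_convexDual_subset_closedBall hd hκ hd1 h] with ω h1 h2 u hu
    exact mem_ball_zero_iff.2 ((mem_closedBall_zero_iff.1 (h2 hu)).lt_of_ne (h1 u hu))
  obtain ⟨n, rfl⟩ : ∃ n, d = n + 1 := ⟨d - 1, by lia⟩
  -- On the line the box mass does not grow with `m`. Instead, any process point on the same side as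
  -- `u` gives `⟨u, x⟩ = ‖x‖ > 1`.
  rcases Nat.eq_zero_or_pos n with rfl | hn
  · filter_upwards [ae_nonempty_inter_of_isOpen hd hκ hd1 h,
      h.ae_subset measurableSet_one_lt_norm (powerIntensity_compl _ _)] with ω h1 h2 u hu hu1
    obtain ⟨x, hx, hux⟩ := h1 u hu1 {x | 0 < inner ℝ u x}
      (isOpen_lt continuous_const (by fun_prop)) (by
        rw [Set.mem_ofPred_eq, real_inner_self_eq_norm_sq, hu1]
        norm_num)
    have hux : 0 < inner ℝ u x := hux
    have hx1 : 1 < ‖x‖ := h2 hx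
    have hle := hu x hx
    have hsq : inner ℝ u x ^ 2 = ‖u‖ ^ 2 * ‖x‖ ^ 2 := by
      rw [EuclideanSpace.real_norm_sq_eq, EuclideanSpace.real_norm_sq_eq, PiLp.inner_apply]
      simp
      ring
    rw [hu1] at hsq
    nlinarith
  · have hc : 0 < κ * (2 / ((n : ℝ) + 1)) ^ n / 10 ^ (n + 1) := by positivity
    have hlim := ENNReal.tendsto_ofReal
      (tendsto_pow_mul_exp_neg_mul hc (by positivity : 0 ≤ (n : ℝ) + 1) (n + 1))
    rw [ENNReal.ofReal_zero] at hlim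
    have hle := ge_of_tendsto hlim (Filter.eventually_atTop.2
      ⟨4, fun m hm => measure_hit_sphere_le hn hκ h hm⟩)
    rw [ae_iff]
    refine le_antisymm ((measure_mono fun ω hω => ?_).trans hle) zero_le
    simpa using hω

end Sphere

end HypVoronoi

/-! ### Proof of both statements and of the formula for `α` -/

theorem theorem3p5 (d : ℕ) (hd : 1 ≤ d) (lam : ℝ) (hlam : 0 < lam)
    {Ω Ω' : Type*} [MeasurableSpace Ω] [MeasurableSpace Ω']
    (P : Measure Ω) [IsProbabilityMeasure P] (P' : Measure Ω') [IsProbabilityMeasure P'] :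
    (∀ β : ℝ, max ((d : ℝ) / 2) 1 < β →
      ∀ (η : Ω → Set (HypVoronoi.Hyperboloid d)) (ζ : Ω' → Set (EuclideanSpace ℝ (Fin d))),
        HypVoronoi.IsPoissonProcess P (HypVoronoi.voronoiIntensity d lam β) η →
        HypVoronoi.IsPoissonProcess P'
          (HypVoronoi.betaStarIntensity d (2 ^ d * lam / HypVoronoi.cTilde d β) β) ζ →
        HypVoronoi.SameLaw
          (fun ω => closure (HypVoronoi.gnomonic ''
            HypVoronoi.voronoiCell (HypVoronoi.apex d) (insert (HypVoronoi.apex d) (η ω)))) P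
          (fun ω' => HypVoronoi.convexDual (HypVoronoi.betaStarSet (ζ ω'))) P') ∧
    (∀ (η : Ω → Set (HypVoronoi.Hyperboloid d)) (ζ : Ω' → Set (EuclideanSpace ℝ (Fin d))),
        HypVoronoi.IsPoissonProcess P (ENNReal.ofReal lam • HypVoronoi.hypVolume d) η →
        HypVoronoi.IsPoissonProcess P'
          (HypVoronoi.betaStarIntensity d (2 ^ d * lam / HypVoronoi.cTilde d d) d) ζ →
        HypVoronoi.SameLaw
          (fun ω => HypVoronoi.gnomonic ''
            HypVoronoi.voronoiCell (HypVoronoi.apex d) (insert (HypVoronoi.apex d) (η ω))) P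
          (fun ω' => HypVoronoi.convexDual (HypVoronoi.betaStarSet (ζ ω'))) P') ∧
    2 ^ d * lam / HypVoronoi.cTilde d d =
      2 ^ d * Real.pi ^ ((d : ℝ) / 2) * lam * Real.Gamma ((d : ℝ) / 2) / Real.Gamma d := by
  have hd0 : (1 : ℝ) ≤ d := by exact_mod_cast hd
  have hκ : 0 < 2 ^ d * lam := by positivity
  refine ⟨fun β hβ η ζ hη hζ => ?_, fun η ζ hη hζ => ?_, ?_⟩
  · obtain ⟨hβ2, hβ1⟩ := max_lt_iff.1 hβ
    have hc := (HypVoronoi.cTilde_pos (by linarith) hβ2).ne'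
    have hT := hη.image HypVoronoi.measurable_bisectorPole HypVoronoi.injective_bisectorPole
    rw [HypVoronoi.map_bisectorPole_voronoiIntensity hd hc] at hT
    refine HypVoronoi.sameLaw_dual hT hζ ?_
    rw [HypVoronoi.betaStarIntensity_eq hc] at hT
    filter_upwards [HypVoronoi.ae_convexDual_subset_closedBall hd hκ hβ1.le hT] with ω hω
    rw [HypVoronoi.gnomonic_image_voronoiCell, HypVoronoi.closure_ball_inter_convexDual hω]
  · have hc : HypVoronoi.cTilde d d ≠ 0 := (HypVoronoi.cTilde_pos (by linarith) (by linarith)).ne'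
    -- The stationary process is handled as the case `β = d`; the dual now lies in the open ball, so
    -- no closure is needed.
    rw [← HypVoronoi.voronoiIntensity_self] at hη
    have hT := hη.image HypVoronoi.measurable_bisectorPole HypVoronoi.injective_bisectorPole
    rw [HypVoronoi.map_bisectorPole_voronoiIntensity hd hc] at hT
    refine HypVoronoi.sameLaw_dual hT hζ ?_
    rw [HypVoronoi.betaStarIntensity_eq hc] at hT
    filter_upwards [HypVoronoi.ae_convexDual_subset_ball hd hκ hT] with ω hω
    rw [HypVoronoi.gnomonic_image_voronoiCell, Set.inter_eq_right.2 hω]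
  · have h1 := Real.Gamma_pos_of_pos (by linarith : (0 : ℝ) < d)
    have h2 := Real.Gamma_pos_of_pos (by linarith : (0 : ℝ) < (d : ℝ) / 2)
    have h3 := Real.pi_pos
    rw [HypVoronoi.cTilde, sub_half]
    field_simp
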